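/- Simplicial complexes are finite and abstract; $S_n(K)$ is the set of $n$-faces (faces with $n+1$ vertices), and $F\in\partial\bar F$ means that the face $F$ arises from the face $\bar F$ by deleting one vertex. A map $\phi\colon V(K)\to V(M)$ is a $k$-fold (strong) covering, $k\ge 1$, if $K$ is connected, $\phi$ maps faces to faces, for every nonempty face $G$ of $M$ the set $\phi^{-1}(G)$ is the union of the faces $F$ of $K$ with $\phi(F)=G$, these are exactly $k$ in number, pairwise disjoint and mapped bijectively onto $G$ by $\phi$, and whenever $G\in\partial\bar G$ in $M$ and $\phi(F)=G$, there is a face $\bar F$ of $K$ with $F\in\partial\bar F$ and $\phi(\bar F)=\bar G$. For a positive weight $w$ on the faces of a complex $M$ and a function $\omega$ on pairs of faces, with $\omega(F,\bar F)\in\mathbb C\setminus\{0\}$ if $F\in\partial\bar F$ and $\omega(F,\bar F)=0$ otherwise, let $C^n(M,\mathbb C)$ be the space of alternating $n$-cochains with inner product $\langle f,g\rangle=\sum_{F\in S_n(M)}w(F)f([F])\overline{g([F])}$, let $$(\delta_n^\omega f)([v_0,\dots,v_{n+1}])=\sum_{j=0}^{n+1}(-1)^j\,\omega(\{v_0,\dots,\hat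 v_j,\dots,v_{n+1}\},\{v_0,\dots,v_{n+1}\})\,f([v_0,\dots,\hat v_j,\dots,v_{n+1}]),$$ and let $\mathcal L_n^{\rm up}(M,\omega)=(\delta_n^\omega)^*\delta_n^\omega$. Write $\mathcal L_n^{\rm up}(M)$ if $\omega=1$ on all pairs with $F\in\partial\bar F$. $\operatorname{Spec}$ is the multiset of eigenvalues. The $i$-th incidence graph $B_i(M)$ has vertex set $S_i(M)\sqcup S_{i+1}(M)$ and edges $\{F,\bar F\}$ with $F\in\partial\bar F$. Given a permutation $\psi(u,v)\in\mathbb S_k$ for each arc of $B_i(M)$, with $\psi(v,u)=\psi(u,v)^{-1}$, the derived graph $B_i(M)^\psi$ has vertex set $(S_i(M)\sqcup S_{i+1}(M))\times[k]$, and $(u,a),(v,b)$ are adjacent iff $u,v$ are adjacent and $a=\psi(u,v)(b)$. **Theorem.** Let $i\ge 0$, let $\phi\colon K\to M$ be a $k$-fold covering, let $w_K,w_M$ be positive weights with $w_K(F)=w_M(\phi(F))$ for all faces $F$ of $K$, and let $\psi$ be a permutation assignment on $B_i(M)$ with an isomorphism $\eta\colon B_i(M)^\psi\to B_i(K)$ such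 that $\phi(\eta(x,l))=x$ for all $x$ and $l$. Suppose that the group $\Psi_i\le\mathbb S_k$ generated by the permutations $\psi(G,\bar G)$, $G\in S_i(M)$, $\bar G\in S_{i+1}(M)$, $G\in\partial\bar G$, is abelian. Then: 1. If $B_i(K)$ is connected (in particular nonempty), then $\Psi_i$ acts regularly on $[k]$ and has exactly $k$ elements. 2. The permutation representation of $\Psi_i$ decomposes into one-dimensional representations $\varrho_1=1,\varrho_2,\dots,\varrho_k$: there is an invertible complex matrix $T$ with $T^{-1}P^gT=\operatorname{diag}(\varrho_1(g),\dots,\varrho_k(g))$ for all $g\in\Psi_i$, where $P^g$ has $(a,b)$ entry $1$ if $a=g(b)$ and $0$ otherwise. 3. For every such decomposition and all incidence weightings $\omega_2,\dots,\omega_k$ of $M$ with $\omega_j(F,\bar F)=\varrho_j(\psi(F,\bar F))$ whenever $F\in S_i(M)$, $\bar F\in S_{i+1}(M)$, $F\in\partial\bar F$, as a multiset union, $$\operatorname{Spec}\mathcal L_i^{\rm up}(K)=\operatorname{Spec}\mathcal L_i^{\rm up}(M)\cup\bigcup_{j=2}^k\operatorname{Spec}\mathcal L_i^{\rm up}(M,\omega_j).$$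 -/

import Mathlib

open scoped ComplexConjugate

noncomputable section

namespace SimplicialCovering

/-! ### Faces, weights and incidences

The vertex type of an `AbstractSimplicialComplex V` is exactly its set of `0`-faces, and the empty
simplex is implicit (faces are nonempty), so an `n`-face is a face with `n + 1` vertices. -/

section Complex

variable {V : Type*} [DecidableEq V]

/-- The set `S_n(K)` of `n`-faces. -/
def Face (K : AbstractSimplicialComplex V) (n : ℕ) : Type _ :=
  {F : Finset V // F ∈ K ∧ F.card = n + 1}

/-- The vertex-edge graph (the 1-skeleton without the empty simplex). -/
def skeletonGraph (K : AbstractSimplicialComplex V) : SimpleGraph V where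
  Adj u v := u ≠ v ∧ ({u, v} : Finset V) ∈ K
  symm := ⟨fun u v h => ⟨h.1.symm, by rw [Finset.pair_comm]; exact h.2⟩⟩
  loopless := ⟨fun _ h => h.1 rfl⟩

/-- `F ∈ ∂ G`: both are faces, and `F` is obtained from `G` by deleting one vertex. -/
def Incident (K : AbstractSimplicialComplex V) (F G : Finset V) : Prop :=
  F ∈ K ∧ G ∈ K ∧ F ⊆ G ∧ G.card = F.card + 1

/-- A positive weight on the faces. -/
structure FaceWeight (K : AbstractSimplicialComplex V) where
  toFun : Finset V → ℝ
  pos : ∀ F ∈ K, 0 < toFun F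

/-- The weighting `ω` of an incidence-weighted complex `(K, ω)`: it is nonzero on incidences and zero
on all other pairs. -/
structure IncidenceWeight (K : AbstractSimplicialComplex V) where
  toFun : Finset V → Finset V → ℂ
  ne_zero_iff : ∀ F G, toFun F G ≠ 0 ↔ Incident K F G

open Classical in
/-- The incidence weighting that is `1` on all incidences, for which `(K, 1)` is the ordinary
complex `K`. -/
def IncidenceWeight.trivial (K : AbstractSimplicialComplex V) : IncidenceWeight K where
  toFun F G := if Incident K F G then 1 else 0
  ne_zero_iff F G := by simp

/-! ### Oriented faces and cochains -/

/-- An `n`-face together with an ordering `[v_0, ..., v_n]` of its vertices. -/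
def OrderedFace (K : AbstractSimplicialComplex V) (n : ℕ) : Type _ :=
  {v : Fin (n + 1) → V // Function.Injective v ∧ Finset.univ.image v ∈ K}

namespace OrderedFace

variable {K : AbstractSimplicialComplex V} {n : ℕ}

instance [Fintype V] : Finite (OrderedFace K n) :=
  inferInstanceAs (Finite {_v : Fin (n + 1) → V // _})

instance [Fintype V] : Fintype (OrderedFace K n) := Fintype.ofFinite _

/-- The underlying unordered face. -/
def face (v : OrderedFace K n) : Finset V := Finset.univ.image v.1

theorem face_mem (v : OrderedFace K n) : v.face ∈ K := v.2.2

/-- Reordering the vertices: `[v_{σ 0}, ..., v_{σ n}]`. -/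
def reorder (v : OrderedFace K n) (σ : Equiv.Perm (Fin (n + 1))) : OrderedFace K n :=
  ⟨v.1 ∘ σ, v.2.1.comp σ.injective, by
    have h : Finset.univ.image (v.1 ∘ σ) = Finset.univ.image v.1 := by
      rw [← Finset.image_image, Finset.image_univ_equiv]
    rw [h]; exact v.2.2⟩

theorem face_reorder (v : OrderedFace K n) (σ : Equiv.Perm (Fin (n + 1))) :
    (v.reorder σ).face = v.face := by
  unfold face reorder
  rw [← Finset.image_image, Finset.image_univ_equiv]

/-- Omitting the `j`-th vertex. -/
def drop (v : OrderedFace K (n + 1)) (j : Fin (n + 2)) : OrderedFace K n :=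
  ⟨v.1 ∘ j.succAbove, v.2.1.comp Fin.succAbove_right_injective, by
    refine (K.isRelLowerSet_faces v.2.2).2 ?_ ?_
    · rw [← Finset.image_image]
      exact Finset.image_subset_image (Finset.subset_univ _)
    · exact Finset.univ_nonempty.image _⟩

end OrderedFace

/-- Alternating functions on ordered `n`-faces. These are exactly the linear functionals on the
space of `n`-chains (oriented faces modulo the relation that opposite orientations add up to `0`). -/
def alternatingFunctions (K : AbstractSimplicialComplex V) (n : ℕ) :
    Submodule ℂ (OrderedFace K n → ℂ) where
  carrier := {f | ∀ v σ, f (v.reorder σ) = ((Equiv.Perm.sign σ : ℤ) : ℂ) * f v}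
  add_mem' hf hg v σ := by simp only [Pi.add_apply, hf v σ, hg v σ]; ring
  zero_mem' v σ := by simp
  smul_mem' c f hf v σ := by simp only [Pi.smul_apply, smul_eq_mul, hf v σ]; ring

/-- The cochain space `C^n(K, ℂ)`; the weight `w` determines its inner product (below). -/
def Cochain (K : AbstractSimplicialComplex V) (_w : FaceWeight K) (n : ℕ) : Type _ :=
  alternatingFunctions K n

namespace Cochain

variable {K : AbstractSimplicialComplex V} {w : FaceWeight K} {n : ℕ}

instance : AddCommGroup (Cochain K w n) :=
  inferInstanceAs (AddCommGroup (alternatingFunctions K n))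

instance : Module ℂ (Cochain K w n) :=
  inferInstanceAs (Module ℂ (alternatingFunctions K n))

instance [Fintype V] : FiniteDimensional ℂ (Cochain K w n) :=
  inferInstanceAs (FiniteDimensional ℂ (alternatingFunctions K n))

/-- The cochain with given values. -/
def mk (f : OrderedFace K n → ℂ)
    (hf : ∀ v σ, f (v.reorder σ) = ((Equiv.Perm.sign σ : ℤ) : ℂ) * f v) : Cochain K w n :=
  ⟨f, hf⟩

/-- The value `f([v_0, ..., v_n])`. -/
def val (f : Cochain K w n) (v : OrderedFace K n) : ℂ := f.1 v

@[ext] theorem ext {f g : Cochain K w n} (h : ∀ v, f.val v = g.val v) : f = g :=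
  Subtype.ext (funext h)

theorem val_reorder (f : Cochain K w n) (v : OrderedFace K n) (σ : Equiv.Perm (Fin (n + 1))) :
    f.val (v.reorder σ) = ((Equiv.Perm.sign σ : ℤ) : ℂ) * f.val v := f.2 v σ

@[simp] theorem val_mk (f : OrderedFace K n → ℂ)
    (hf : ∀ v σ, f (v.reorder σ) = ((Equiv.Perm.sign σ : ℤ) : ℂ) * f v) (v : OrderedFace K n) :
    (mk f hf : Cochain K w n).val v = f v := rfl

@[simp] theorem val_zero (v : OrderedFace K n) : (0 : Cochain K w n).val v = 0 := rfl

@[simp] theorem val_add (f g : Cochain K w n) (v : OrderedFace K n) :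
    (f + g).val v = f.val v + g.val v := rfl

@[simp] theorem val_smul (c : ℂ) (f : Cochain K w n) (v : OrderedFace K n) :
    (c • f).val v = c * f.val v := rfl

variable [Fintype V]

/-- The inner product `∑_F w(F) f([F]) conj (g([F]))` over the `n`-faces `F`, conjugate-linear in the
first variable as in Mathlib. The summand does not depend on the ordering of the vertices of `F`, and
each face has `(n + 1)!` orderings. -/
abbrev innerCore (K : AbstractSimplicialComplex V) (w : FaceWeight K) (n : ℕ) :
    InnerProductSpace.Core ℂ (Cochain K w n) where
  inner f g := ((n + 1).factorial : ℂ)⁻¹ *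
    ∑ v : OrderedFace K n, (w.toFun v.face : ℂ) * (conj (f.val v) * g.val v)
  conj_inner_symm f g := by
    simp only [map_mul, map_sum, map_inv₀, map_natCast, Complex.conj_ofReal, Complex.conj_conj]
    congr 1
    exact Finset.sum_congr rfl fun v _ => by ring
  re_inner_nonneg f := by
    have h : ((n + 1).factorial : ℂ)⁻¹ *
        ∑ v : OrderedFace K n, (w.toFun v.face : ℂ) * (conj (f.val v) * f.val v) =
        ((((n + 1).factorial : ℝ)⁻¹ *
          ∑ v : OrderedFace K n, w.toFun v.face * Complex.normSq (f.val v) : ℝ) : ℂ) := by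
      push_cast
      simp only [Complex.normSq_eq_conj_mul_self]
    rw [h, RCLike.re_eq_complex_re, Complex.ofReal_re]
    exact mul_nonneg (by positivity) (Finset.sum_nonneg fun v _ =>
      mul_nonneg (w.pos _ v.face_mem).le (Complex.normSq_nonneg _))
  add_left f g h := by
    rw [← mul_add, ← Finset.sum_add_distrib]
    congr 1
    exact Finset.sum_congr rfl fun v _ => by simp only [val_add, map_add]; ring
  smul_left f g c := by
    rw [mul_left_comm, Finset.mul_sum (a := conj c)]
    congr 1
    exact Finset.sum_congr rfl fun v _ => by simp only [val_smul, map_mul]; ring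
  definite f hf := by
    have h : ((n + 1).factorial : ℂ)⁻¹ *
        ∑ v : OrderedFace K n, (w.toFun v.face : ℂ) * (conj (f.val v) * f.val v) =
        ((((n + 1).factorial : ℝ)⁻¹ *
          ∑ v : OrderedFace K n, w.toFun v.face * Complex.normSq (f.val v) : ℝ) : ℂ) := by
      push_cast
      simp only [Complex.normSq_eq_conj_mul_self]
    have h0 := h.symm.trans hf
    rw [Complex.ofReal_eq_zero] at h0
    have h1 := (mul_eq_zero.mp h0).resolve_left (by positivity)
    rw [Finset.sum_eq_zero_iff_of_nonneg fun v _ =>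
      mul_nonneg (w.pos _ v.face_mem).le (Complex.normSq_nonneg _)] at h1
    ext v
    exact Complex.normSq_eq_zero.mp
      ((mul_eq_zero.mp (h1 v (Finset.mem_univ v))).resolve_left (w.pos _ v.face_mem).ne')

instance : NormedAddCommGroup (Cochain K w n) := (innerCore K w n).toNormedAddCommGroup

instance : InnerProductSpace ℂ (Cochain K w n) := InnerProductSpace.ofCore (innerCore K w n).toCore

theorem inner_eq (f g : Cochain K w n) : inner ℂ f g = ((n + 1).factorial : ℂ)⁻¹ *
    ∑ v : OrderedFace K n, (w.toFun v.face : ℂ) * (conj (f.val v) * g.val v) := rfl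

end Cochain

/-! ### Coboundary maps and Laplace operators -/

/-- The permutation which `σ` induces between the complements of `j` and of `σ j`. -/
def inducedPerm {n : ℕ} (σ : Equiv.Perm (Fin (n + 2))) (j : Fin (n + 2)) :
    Equiv.Perm (Fin (n + 1)) :=
  (Equiv.Perm.decomposeFin ((σ j).cycleRange * σ * j.cycleRange⁻¹)).2

theorem inducedPerm_spec {n : ℕ} (σ : Equiv.Perm (Fin (n + 2))) (j : Fin (n + 2)) :
    (∀ a, σ (j.succAbove a) = (σ j).succAbove (inducedPerm σ j a)) ∧
      (-1 : ℤ) ^ (j : ℕ) * (Equiv.Perm.sign (inducedPerm σ j) : ℤ) =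
        (Equiv.Perm.sign σ : ℤ) * (-1) ^ ((σ j : Fin (n + 2)) : ℕ) := by
  set τ : Equiv.Perm (Fin (n + 2)) := (σ j).cycleRange * σ * j.cycleRange⁻¹ with hτ
  have h0 : τ 0 = 0 := by
    rw [hτ, Equiv.Perm.mul_apply, Equiv.Perm.mul_apply, Equiv.Perm.inv_def,
      Fin.cycleRange_symm_zero, Fin.cycleRange_self]
  obtain ⟨⟨p, e⟩, hpe⟩ : ∃ x, Equiv.Perm.decomposeFin τ = x := ⟨_, rfl⟩
  have he : inducedPerm σ j = e := by
    change (Equiv.Perm.decomposeFin τ).2 = e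
    rw [hpe]
  have hτe : τ = Equiv.Perm.decomposeFin.symm (p, e) := by
    rw [← hpe, Equiv.symm_apply_apply]
  have hp : p = 0 := by
    rw [hτe, Equiv.Perm.decomposeFin_symm_apply_zero] at h0
    exact h0
  subst hp
  rw [he]
  constructor
  · intro a
    have h1 : τ a.succ = (e a).succ := by
      rw [hτe, Equiv.Perm.decomposeFin_symm_apply_succ]
      simp
    rw [hτ] at h1
    simp only [Equiv.Perm.mul_apply, Equiv.Perm.inv_def, Fin.cycleRange_symm_succ] at h1
    rw [← Fin.cycleRange_symm_succ (σ j), ← h1, Equiv.symm_apply_apply]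
  · have h2 : Equiv.Perm.sign τ = Equiv.Perm.sign e := by
      rw [hτe, Equiv.Perm.decomposeFin.symm_sign]
      simp
    rw [← h2, hτ]
    simp only [map_mul, Equiv.Perm.sign_inv, Fin.sign_cycleRange]
    push_cast
    have h3 : ((-1 : ℤ) ^ (j : ℕ)) * (-1) ^ (j : ℕ) = 1 := by
      rw [← mul_pow]; simp
    linear_combination ((-1 : ℤ) ^ ((σ j : Fin (n + 2)) : ℕ) * (Equiv.Perm.sign σ : ℤ)) * h3

theorem OrderedFace.drop_reorder {K : AbstractSimplicialComplex V} {n : ℕ}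
    (v : OrderedFace K (n + 1)) (σ : Equiv.Perm (Fin (n + 2))) (j : Fin (n + 2)) :
    (v.reorder σ).drop j = (v.drop (σ j)).reorder (inducedPerm σ j) := by
  apply Subtype.ext
  funext a
  exact congrArg v.1 ((inducedPerm_spec σ j).1 a)

/-- The weighted coboundary map
`(δ^ω f)([v_0, ..., v_{n+1}]) = ∑_j (-1)^j ω(F_j, F) f([v_0, ..., v̂_j, ..., v_{n+1}])`, where
`F = {v_0, ..., v_{n+1}}` and `F_j = F \ {v_j}`. -/
def coboundary (K : AbstractSimplicialComplex V) (w : FaceWeight K) (ω : IncidenceWeight K) (n : ℕ) :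
    Cochain K w n →ₗ[ℂ] Cochain K w (n + 1) where
  toFun f := Cochain.mk (fun v => ∑ j : Fin (n + 2),
      (-1) ^ (j : ℕ) * ω.toFun (v.drop j).face v.face * f.val (v.drop j)) <| by
    intro v σ
    rw [Finset.mul_sum]
    refine Eq.trans (Finset.sum_congr rfl fun j _ => ?_) (Equiv.sum_comp σ _)
    rw [v.drop_reorder σ j, OrderedFace.face_reorder, OrderedFace.face_reorder,
      Cochain.val_reorder]
    have h := congrArg (Int.cast : ℤ → ℂ) (inducedPerm_spec σ j).2
    push_cast at h
    linear_combination (ω.toFun (v.drop (σ j)).face v.face * f.val (v.drop (σ j))) * h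
  map_add' f g := by
    ext v
    simp only [Cochain.val_add, Cochain.val_mk, ← Finset.sum_add_distrib, mul_add]
  map_smul' c f := by
    ext v
    simp only [Cochain.val_smul, Cochain.val_mk, RingHom.id_apply, Finset.mul_sum]
    exact Finset.sum_congr rfl fun j _ => mul_left_comm _ _ _

theorem coboundary_val (K : AbstractSimplicialComplex V) (w : FaceWeight K) (ω : IncidenceWeight K)
    (n : ℕ) (f : Cochain K w n) (v : OrderedFace K (n + 1)) :
    (coboundary K w ω n f).val v = ∑ j : Fin (n + 2),
      (-1) ^ (j : ℕ) * ω.toFun (v.drop j).face v.face * f.val (v.drop j) := rfl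

variable [Fintype V]

/-- The `n`-up Laplace operator `(δ^ω)^* δ^ω` of the incidence-weighted complex `(K, ω)`. -/
def weightedUpLaplacian (K : AbstractSimplicialComplex V) (w : FaceWeight K)
    (ω : IncidenceWeight K) (n : ℕ) : Cochain K w n →ₗ[ℂ] Cochain K w n :=
  LinearMap.adjoint (coboundary K w ω n) ∘ₗ coboundary K w ω n

/-- The `n`-up Laplace operator of `K`. -/
def upLaplacian (K : AbstractSimplicialComplex V) (w : FaceWeight K) (n : ℕ) :
    Cochain K w n →ₗ[ℂ] Cochain K w n :=
  weightedUpLaplacian K w (IncidenceWeight.trivial K) n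

/-- The spectrum of an operator on a finite-dimensional space: the multiset of its eigenvalues. -/
def Spec {E : Type*} [AddCommGroup E] [Module ℂ E] [FiniteDimensional ℂ E] (L : E →ₗ[ℂ] E) :
    Multiset ℂ :=
  L.charpoly.roots

/-! ### Incidence graphs -/

/-- Adjacency in the incidence graph: one of the two faces lies in the boundary of the other. -/
def incidenceAdj (K : AbstractSimplicialComplex V) (n : ℕ) :
    Face K n ⊕ Face K (n + 1) → Face K n ⊕ Face K (n + 1) → Prop
  | .inl F, .inr G => Incident K F.1 G.1
  | .inr G, .inl F => Incident K F.1 G.1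
  | _, _ => False

/-- The `n`-th incidence graph `B_n(K)`. -/
def incidenceGraph (K : AbstractSimplicialComplex V) (n : ℕ) :
    SimpleGraph (Face K n ⊕ Face K (n + 1)) where
  Adj := incidenceAdj K n
  symm := ⟨by rintro (F | F) (G | G) h <;> exact h⟩
  loopless := ⟨by rintro (F | F) h <;> exact h⟩

/-- The face of `K` which a vertex of `B_n(K)` is. -/
def toFace {K : AbstractSimplicialComplex V} {n : ℕ} : Face K n ⊕ Face K (n + 1) → Finset V
  | .inl F => F.1
  | .inr G => G.1

end Complex

/-! ### Coverings -/

section Covering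

variable {V W : Type*} [DecidableEq V] [DecidableEq W]

/-- `φ : K → M` is a strong covering: `K` is connected, `φ` is a simplicial map, and for every face
`G` of `M` the preimage `φ⁻¹(G)` is the union of the faces `F` of `K` over `G`, which are pairwise
disjoint and mapped bijectively to `G`; moreover, if `G ∈ ∂ G'` and `F` lies over `G`, then `F ∈ ∂ F'`
for some face `F'` over `G'`. -/
structure IsStrongCovering (K : AbstractSimplicialComplex V) (M : AbstractSimplicialComplex W)
    (φ : V → W) : Prop where
  connected : (skeletonGraph K).Connected
  map_mem : ∀ F ∈ K, F.image φ ∈ M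
  injOn : ∀ F ∈ K, Set.InjOn φ (F : Set V)
  disjoint : ∀ F ∈ K, ∀ F' ∈ K, F.image φ = F'.image φ → F ≠ F' → Disjoint F F'
  preimage_eq : ∀ G ∈ M,
    φ ⁻¹' (G : Set W) = ⋃ F ∈ {F : Finset V | F ∈ K ∧ F.image φ = G}, (F : Set V)
  lift : ∀ G G', Incident M G G' → ∀ F ∈ K, F.image φ = G →
    ∃ F' ∈ K, Incident K F F' ∧ F'.image φ = G'

/-- A `k`-fold covering: a strong covering such that every face of `M` has exactly `k` faces of `K`
over it. -/
structure IsFoldCovering (K : AbstractSimplicialComplex V) (M : AbstractSimplicialComplex W)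
    (φ : V → W) (k : ℕ) : Prop extends IsStrongCovering K M φ where
  fiber : ∀ G ∈ M, {F : Finset V | F ∈ K ∧ F.image φ = G}.ncard = k

end Covering

/-! ### Permutation voltages and derived graphs -/

/-- A permutation assignment on the arcs of (the symmetric digraph of) a graph, with inverse
permutations on opposite arcs. The values on pairs that are not arcs are irrelevant. -/
structure PermVoltage {X : Type*} (B : SimpleGraph X) (k : ℕ) where
  toFun : X → X → Equiv.Perm (Fin k)
  inv_eq : ∀ u v, B.Adj u v → toFun v u = (toFun u v)⁻¹

/-- The derived graph `B^ψ`: `(u, a)` and `(v, b)` are adjacent iff `u` and `v` are adjacent and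
`a = ψ(u, v)(b)`. -/
def derivedGraph {X : Type*} {B : SimpleGraph X} {k : ℕ} (ψ : PermVoltage B k) :
    SimpleGraph (X × Fin k) where
  Adj p q := B.Adj p.1 q.1 ∧ p.2 = ψ.toFun p.1 q.1 q.2
  symm := ⟨fun p q h => ⟨h.1.symm, by
    rw [ψ.inv_eq p.1 q.1 h.1, h.2]; simp⟩⟩
  loopless := ⟨fun p h => B.loopless.irrefl p.1 h.1⟩

section Voltage

variable {W : Type*} [DecidableEq W] {M : AbstractSimplicialComplex W} {i k : ℕ}

/-- The voltage group `Ψ_i`, generated by the permutations `ψ(G, G')` with `G ∈ ∂ G'`. -/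
def voltageGroup (ψ : PermVoltage (incidenceGraph M i) k) : Subgroup (Equiv.Perm (Fin k)) :=
  Subgroup.closure {g | ∃ (G : Face M i) (G' : Face M (i + 1)),
    Incident M G.1 G'.1 ∧ ψ.toFun (.inl G) (.inr G') = g}

/-- `ψ(G, G')` as an element of the voltage group. -/
def voltage (ψ : PermVoltage (incidenceGraph M i) k) (G : Face M i) (G' : Face M (i + 1))
    (h : Incident M G.1 G'.1) : voltageGroup ψ :=
  ⟨ψ.toFun (.inl G) (.inr G'), Subgroup.subset_closure ⟨G, G', h, rfl⟩⟩

end Voltage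

/-- The permutation matrix `P^g`, with `(a, b)` entry `1` if `a = g(b)` and `0` otherwise. -/
def permutationMatrix {k : ℕ} (g : Equiv.Perm (Fin k)) : Matrix (Fin k) (Fin k) ℂ :=
  Matrix.of fun a b => if a = g b then 1 else 0

/-- The invertible matrix `T` decomposes the permutation representation `g ↦ P^g` of `Ψ` into the
one-dimensional representations `ϱ_0 = 1, ϱ_1, ..., ϱ_{k-1}`. -/
structure IsCharacterDecomposition {k : ℕ} [NeZero k] (Ψ : Subgroup (Equiv.Perm (Fin k)))
    (ϱ : Fin k → (Ψ →* ℂˣ)) (T : Matrix (Fin k) (Fin k) ℂ) : Prop where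
  isUnit : IsUnit T
  first : ϱ 0 = 1
  decomp : ∀ g : Ψ, T⁻¹ * permutationMatrix (g : Equiv.Perm (Fin k)) * T =
    Matrix.diagonal fun j => ((ϱ j g : ℂˣ) : ℂ)

end SimplicialCovering

end

open SimplicialCovering

/-!
Through `η`, the faces of `K` of dimensions `i` and `i + 1` over a face of `M` are labelled by
`[k]`, and the labels of incident faces differ by a voltage. Row `j` of `T⁻¹` satisfies
`T⁻¹ j (g b) = ϱ_j(g) T⁻¹ j b`, so weighting the pullback along `φ` by this row intertwines the
coboundary of `(M, ω_j)` with that of `K`. The adjoint of the weighted pullback is a weighted sum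
over fibres, which intertwines the coboundaries as well because `|ϱ_j| = 1`. Hence the pullback
intertwines the up Laplacians, and as `T` is invertible, the `k` weighted pullbacks together
identify `k` copies of `C^i(M, ℂ)` with `C^i(K, ℂ)`.

A commuting family of matrices of finite order is simultaneously diagonalizable, which gives the
decomposition of the permutation representation, and a transitive abelian permutation group is
regular.
-/

namespace SimplicialCovering

open scoped Matrix

section LinearAlgebra

theorem charpoly_pi {R E ι : Type*} [CommRing R] [IsDomain R] [Infinite R] [AddCommGroup E]
    [Module R E] [Module.Free R E] [Module.Finite R E] [Fintype ι] (f : ι → E →ₗ[R] E) :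
    (LinearMap.pi fun j => f j ∘ₗ LinearMap.proj j).charpoly = ∏ j, (f j).charpoly := by
  refine Polynomial.funext fun t => ?_
  simp only [Polynomial.eval_prod, LinearMap.eval_charpoly]
  exact LinearMap.det_pi fun j => algebraMap R (Module.End R E) t - f j

theorem spec_eq_sum {ι E E' : Type*} [Fintype ι]
    [AddCommGroup E] [Module ℂ E] [FiniteDimensional ℂ E]
    [AddCommGroup E'] [Module ℂ E'] [FiniteDimensional ℂ E']
    (e : (ι → E) ≃ₗ[ℂ] E') {L' : E' →ₗ[ℂ] E'} {L : ι → E →ₗ[ℂ] E}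
    (h : ∀ f, L' (e f) = e fun j => L j (f j)) :
    Spec L' = ∑ j, Spec (L j) := by
  have hL' : L' = e.conj (LinearMap.pi fun j => L j ∘ₗ LinearMap.proj j) :=
    LinearMap.ext fun x => by
      rw [LinearEquiv.conj_apply_apply, ← e.apply_symm_apply x, h, e.symm_apply_apply]
      rfl
  have hne : ∏ j, (L j).charpoly ≠ 0 :=
    Finset.prod_ne_zero_iff.mpr fun j _ => (L j).charpoly_monic.ne_zero
  rw [Spec, hL', LinearEquiv.charpoly_conj, charpoly_pi, Polynomial.roots_prod _ _ hne]
  rfl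

theorem adjoint_comp_self_comp_eq {𝕜 E E' F F' : Type*} [RCLike 𝕜]
    [NormedAddCommGroup E] [InnerProductSpace 𝕜 E] [FiniteDimensional 𝕜 E]
    [NormedAddCommGroup E'] [InnerProductSpace 𝕜 E'] [FiniteDimensional 𝕜 E']
    [NormedAddCommGroup F] [InnerProductSpace 𝕜 F] [FiniteDimensional 𝕜 F]
    [NormedAddCommGroup F'] [InnerProductSpace 𝕜 F'] [FiniteDimensional 𝕜 F']
    {d : E →ₗ[𝕜] F} {d' : E' →ₗ[𝕜] F'} {U : E →ₗ[𝕜] E'} {U₁ : F →ₗ[𝕜] F'}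
    (h : d' ∘ₗ U = U₁ ∘ₗ d)
    (hadj : LinearMap.adjoint U₁ ∘ₗ d' = d ∘ₗ LinearMap.adjoint U) :
    (LinearMap.adjoint d' ∘ₗ d') ∘ₗ U = U ∘ₗ LinearMap.adjoint d ∘ₗ d := by
  have hadj' : LinearMap.adjoint d' ∘ₗ U₁ = U ∘ₗ LinearMap.adjoint d := by
    simpa only [LinearMap.adjoint_comp, LinearMap.adjoint_adjoint] using
      congrArg LinearMap.adjoint hadj
  rw [LinearMap.comp_assoc, h, ← LinearMap.comp_assoc, hadj', LinearMap.comp_assoc]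

theorem exists_basis_apply_eq {F E ι : Type*} [Field F] [AddCommGroup E] [Module F E]
    (b₀ : Module.Basis ι F E) (i : ι) {s : Set E} (hs : Submodule.span F s = ⊤) {v : E}
    (hv : v ∈ s) (hv0 : v ≠ 0) :
    ∃ b : Module.Basis ι F E, b i = v ∧ ∀ j, b j ∈ s := by
  classical
  have hli : LinearIndepOn F id {v} := LinearIndepOn.singleton (v := id) hv0
  have hvs : {v} ⊆ s := Set.singleton_subset_iff.mpr hv
  let b' := Module.Basis.extendLe hli hvs hs.ge
  have hb' : ∀ x, b' x = x := Module.Basis.extendLe_apply_self hli hvs hs.ge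
  let x₀ : hli.extend hvs := ⟨v, hli.subset_extend hvs rfl⟩
  let e := b'.indexEquiv b₀
  refine ⟨b'.reindex (e.trans (Equiv.swap (e x₀) i)), ?_, fun j => ?_⟩
  · simp [hb', x₀]
  · rw [b'.reindex_apply, hb']
    exact hli.extend_subset hvs (Subtype.coe_prop _)

end LinearAlgebra

section Characters

variable {F G E : Type*} [Field F] [Group G] [AddCommGroup E] [Module F E]

/-- The common eigenvectors of a representation, that is, the nonzero vectors on which `G` acts
through a character. -/
def characterVectors (ρ : Representation F G E) : Set E :=
  {v | v ≠ 0 ∧ ∃ χ : G →* Fˣ, ∀ g, ρ g v = (χ g : F) • v}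

theorem mem_characterVectors_of_forall_exists (ρ : Representation F G E) {v : E} (hv : v ≠ 0)
    (h : ∀ g, ∃ c : F, ρ g v = c • v) : v ∈ characterVectors ρ := by
  choose c hc using h
  have hone : c 1 = 1 := smul_left_injective F hv <| by
    simp only [← hc, map_one, Module.End.one_apply, one_smul]
  have hmul : ∀ g h, c (g * h) = c g * c h := fun g h => smul_left_injective F hv <| by
    simp only
    rw [← hc, map_mul, Module.End.mul_apply, hc h, map_smul, hc g, smul_smul, mul_comm]
  exact ⟨hv, MonoidHom.toHomUnits ⟨⟨c, hone⟩, hmul⟩, hc⟩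

theorem isSemisimple_of_pow_eq_one {f : Module.End F E} {n : ℕ} (hn : (n : F) ≠ 0)
    (h : f ^ n = 1) : f.IsSemisimple :=
  Module.End.isSemisimple_of_squarefree_aeval_eq_zero
    (Polynomial.X_pow_sub_one_separable_iff.mpr hn).squarefree (by simp [h])

theorem span_characterVectors_eq_top [Finite G] [IsMulCommutative G] [IsAlgClosed F]
    [FiniteDimensional F E] (hG : (Nat.card G : F) ≠ 0) (ρ : Representation F G E) :
    Submodule.span F (characterVectors ρ) = ⊤ := by
  have hcomm : Pairwise fun g h => Commute (ρ g) (ρ h) := fun g h _ =>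
    (show Commute g h from mul_comm' g h).map ρ
  have hss : ∀ g, Module.End.IsSemisimple (ρ g) := fun g =>
    isSemisimple_of_pow_eq_one hG (by rw [← map_pow, pow_card_eq_one', map_one])
  rw [eq_top_iff,
    ← Module.End.iSup_iInf_maxGenEigenspace_eq_top_of_iSup_maxGenEigenspace_eq_top_of_commute ρ
      hcomm fun g => Module.End.iSup_maxGenEigenspace_eq_top (ρ g)]
  refine iSup_le fun c v hv => ?_
  rcases eq_or_ne v 0 with rfl | hv0
  · exact zero_mem _
  · refine Submodule.subset_span (mem_characterVectors_of_forall_exists ρ hv0 fun g => ⟨c g, ?_⟩)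
    have hvg := (Submodule.mem_iInf _).mp hv g
    rw [(hss g).isFinitelySemisimple.maxGenEigenspace_eq_eigenspace] at hvg
    exact Module.End.mem_eigenspace_iff.mp hvg

theorem exists_inv_mul_mul_eq_diagonal [Finite G] [IsMulCommutative G] [IsAlgClosed F]
    (hG : (Nat.card G : F) ≠ 0) {n : Type*} [Fintype n] [DecidableEq n]
    (A : G →* Matrix n n F) (i : n) {v : n → F} (hv : v ≠ 0) {χ₀ : G →* Fˣ}
    (hχ₀ : ∀ g, A g *ᵥ v = (χ₀ g : F) • v) :
    ∃ (χ : n → G →* Fˣ) (T : Matrix n n F), IsUnit T ∧ χ i = χ₀ ∧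
      ∀ g, T⁻¹ * A g * T = Matrix.diagonal fun j => (χ j g : F) := by
  let ρ : Representation F G (n → F) := (Matrix.toLinAlgEquiv' : _ ≃ₐ[F] _).toMonoidHom.comp A
  obtain ⟨b, hbi, hb⟩ := exists_basis_apply_eq (Pi.basisFun F n) i
    (span_characterVectors_eq_top hG ρ) (v := v) ⟨hv, χ₀, hχ₀⟩ hv
  choose _ χ hχ using hb
  let T := (Pi.basisFun F n).toMatrix b
  have hT : IsUnit T := by
    let := (Pi.basisFun F n).invertibleToMatrix b
    exact isUnit_of_invertible T
  refine ⟨χ, T, hT, ?_, fun g => ?_⟩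
  · ext g
    refine smul_left_injective F hv ?_
    change (χ i g : F) • v = (χ₀ g : F) • v
    rw [← hχ₀, ← hbi]
    exact (hχ i g).symm
  · have hcol : A g * T = T * Matrix.diagonal fun j => (χ j g : F) := by
      ext a j
      rw [Matrix.mul_diagonal, mul_comm]
      exact congrFun (hχ j g) a
    rw [mul_assoc, hcol, Matrix.nonsing_inv_mul_cancel_left _ _
      ((Matrix.isUnit_iff_isUnit_det T).mp hT)]

theorem conj_mul_character [Finite G] (χ : G →* ℂˣ) (g : G) :
    conj (χ g : ℂ) * (χ g : ℂ) = 1 := by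
  have hnorm : ‖(χ g : ℂ)‖ = 1 :=
    (((Units.coeHom ℂ).comp χ).isOfFinOrder (isOfFinOrder_of_finite g)).norm_eq_one
  rw [Complex.conj_mul', hnorm, Complex.ofReal_one, one_pow]

end Characters

section PermutationGroups

theorem existsUnique_apply_eq_of_transitive {X : Type*} {Ψ : Subgroup (Equiv.Perm X)}
    (hab : ∀ g ∈ Ψ, ∀ h ∈ Ψ, g * h = h * g) (htr : ∀ a b : X, ∃ g ∈ Ψ, g a = b) (a b : X) :
    ∃! g : Ψ, (g : Equiv.Perm X) a = b := by
  obtain ⟨g, hg, rfl⟩ := htr a b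
  refine ⟨⟨g, hg⟩, rfl, fun h hh => Subtype.ext (Equiv.ext fun c => ?_)⟩
  obtain ⟨t, ht, rfl⟩ := htr a c
  calc (h : Equiv.Perm X) (t a) = t ((h : Equiv.Perm X) a) :=
        DFunLike.congr_fun (hab _ h.2 t ht) a
    _ = t (g a) := by rw [hh]
    _ = g (t a) := DFunLike.congr_fun (hab t ht g hg) a

theorem card_eq_of_existsUnique_apply_eq {X : Type*} (Ψ : Subgroup (Equiv.Perm X)) (a : X)
    (h : ∀ b, ∃! g : Ψ, (g : Equiv.Perm X) a = b) : Nat.card Ψ = Nat.card X :=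
  Nat.card_eq_of_bijective (fun g : Ψ => (g : Equiv.Perm X) a)
    ((Function.bijective_iff_existsUnique _).mpr h)

variable {k : ℕ}

theorem permutationMatrix_eq_permMatrixHom (g : Equiv.Perm (Fin k)) :
    permutationMatrix g = Matrix.permMatrixHom g := by
  ext a b
  simp [permutationMatrix, PEquiv.toMatrix_apply, Equiv.toPEquiv_apply, Equiv.symm_apply_eq]

variable [NeZero k] {Ψ : Subgroup (Equiv.Perm (Fin k))}

theorem exists_isCharacterDecomposition (hab : ∀ g ∈ Ψ, ∀ h ∈ Ψ, g * h = h * g) :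
    ∃ ϱ T, IsCharacterDecomposition Ψ ϱ T := by
  have : IsMulCommutative Ψ := .of_comm fun g h => Subtype.ext (hab g g.2 h h.2)
  let A : Ψ →* Matrix (Fin k) (Fin k) ℂ := Matrix.permMatrixHom.comp Ψ.subtype
  have hone : ∀ g, A g *ᵥ 1 = (((1 : Ψ →* ℂˣ) g : ℂˣ) : ℂ) • (1 : Fin k → ℂ) := fun g => by
    change Equiv.Perm.permMatrix ℂ _ *ᵥ 1 = _
    rw [Matrix.permMatrix_mulVec, MonoidHom.one_apply, Units.val_one, one_smul]
    rfl
  obtain ⟨ϱ, T, hT, hfirst, hdecomp⟩ := exists_inv_mul_mul_eq_diagonal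
    (Nat.cast_ne_zero.mpr Nat.card_pos.ne') A 0 one_ne_zero hone
  exact ⟨ϱ, T, hT, hfirst, fun g => permutationMatrix_eq_permMatrixHom (g : Equiv.Perm (Fin k)) ▸
    hdecomp g⟩

variable {ϱ : Fin k → (Ψ →* ℂˣ)} {T : Matrix (Fin k) (Fin k) ℂ}

theorem IsCharacterDecomposition.isUnit_det (h : IsCharacterDecomposition Ψ ϱ T) :
    IsUnit T.det :=
  (Matrix.isUnit_iff_isUnit_det T).mp h.isUnit

theorem IsCharacterDecomposition.inv_apply_perm (h : IsCharacterDecomposition Ψ ϱ T) (g : Ψ)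
    (j b : Fin k) :
    T⁻¹ j ((g : Equiv.Perm (Fin k)) b) = ((ϱ j g : ℂˣ) : ℂ) * T⁻¹ j b := by
  have hrow : T⁻¹ * permutationMatrix (g : Equiv.Perm (Fin k)) =
      Matrix.diagonal (fun j => ((ϱ j g : ℂˣ) : ℂ)) * T⁻¹ := by
    rw [← h.decomp g, Matrix.mul_nonsing_inv_cancel_right _ _ h.isUnit_det]
  have hentry := congrFun₂ hrow j b
  rw [Matrix.diagonal_mul] at hentry
  simpa [permutationMatrix, Matrix.mul_apply] using hentry

end PermutationGroups

section OrderedFaces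

variable {V W : Type*} [DecidableEq V] {K : AbstractSimplicialComplex V}
  {M : AbstractSimplicialComplex W} {φ : V → W} {n : ℕ}

namespace OrderedFace

theorem card_face (v : OrderedFace K n) : v.face.card = n + 1 := by
  rw [face, Finset.card_image_of_injective _ v.2.1, Finset.card_univ, Fintype.card_fin]

/-- The face underlying an ordered face, as an element of `S_n(K)`. -/
def toFace (v : OrderedFace K n) : Face K n :=
  ⟨v.face, v.face_mem, v.card_face⟩

theorem toFace_reorder (v : OrderedFace K n) (σ : Equiv.Perm (Fin (n + 1))) :
    (v.reorder σ).toFace = v.toFace :=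
  Subtype.ext (v.face_reorder σ)

theorem apply_mem_face (v : OrderedFace K n) (a : Fin (n + 1)) : v.1 a ∈ v.face :=
  Finset.mem_image_of_mem _ (Finset.mem_univ a)

theorem incident_drop (v : OrderedFace K (n + 1)) (j : Fin (n + 2)) :
    Incident K (v.drop j).face v.face := by
  refine ⟨(v.drop j).face_mem, v.face_mem, ?_, by rw [v.card_face, (v.drop j).card_face]⟩
  exact Finset.image_subset_iff.mpr fun a _ => v.apply_mem_face (j.succAbove a)

theorem trivial_toFun_drop (v : OrderedFace K (n + 1)) (j : Fin (n + 2)) :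
    (IncidenceWeight.trivial K).toFun (v.drop j).face v.face = 1 :=
  if_pos (v.incident_drop j)

theorem eq_of_comp_eq {v v' : OrderedFace K n} (hφ : Set.InjOn φ (v.face : Set V))
    (hface : v.face = v'.face) (h : φ ∘ v.1 = φ ∘ v'.1) : v = v' :=
  Subtype.ext <| funext fun a =>
    hφ (v.apply_mem_face a) (hface ▸ v'.apply_mem_face a) (congrFun h a)

theorem exists_lift [DecidableEq W] (F : Face K n) (u : OrderedFace M n)
    (h : F.1.image φ = u.face) : ∃ v : OrderedFace K n, v.toFace = F ∧ φ ∘ v.1 = u.1 := by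
  have hmem : ∀ a, ∃ x ∈ F.1, φ x = u.1 a := fun a => by
    rw [← Finset.mem_image, h]
    exact u.apply_mem_face a
  choose x hxF hx using hmem
  have hinj : Function.Injective x := fun a b hab => u.2.1 (by rw [← hx, ← hx, hab])
  have himage : Finset.univ.image x = F.1 := by
    refine Finset.eq_of_subset_of_card_le (Finset.image_subset_iff.mpr fun a _ => hxF a) ?_
    rw [F.2.2, Finset.card_image_of_injective _ hinj, Finset.card_univ, Fintype.card_fin]
  exact ⟨⟨x, hinj, himage ▸ F.2.1⟩, Subtype.ext himage, funext hx⟩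

end OrderedFace

end OrderedFaces

section Labellings

variable {V W : Type*} [DecidableEq W] {K : AbstractSimplicialComplex V}
  {M : AbstractSimplicialComplex W} {φ : V → W} {n : ℕ} {ι : Type*}

/-- A labelling by `ι` of the `n`-faces of `K` over each `n`-face of `M`: the bijection sends a face
to its image under `φ` and its label. -/
structure FaceLabelling (K : AbstractSimplicialComplex V) (M : AbstractSimplicialComplex W)
    (φ : V → W) (n : ℕ) (ι : Type*) where
  equiv : Face K n ≃ Face M n × ι
  image_eq : ∀ F, F.1.image φ = (equiv F).1.1

namespace FaceLabelling

variable (Λ : FaceLabelling K M φ n ι)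

/-- The label of a face. -/
def label (F : Face K n) : ι := (Λ.equiv F).2

include Λ in
theorem injOn (F : Face K n) : Set.InjOn φ (F.1 : Set V) :=
  Finset.card_image_iff.mp (by rw [Λ.image_eq, (Λ.equiv F).1.2.2, F.2.2])

variable [DecidableEq V]

theorem image_comp_eq (v : OrderedFace K n) :
    Finset.univ.image (φ ∘ v.1) = (Λ.equiv v.toFace).1.1 := by
  rw [← Finset.image_image]
  exact Λ.image_eq v.toFace

/-- The image `[φ v_0, ..., φ v_n]` of an ordered face `[v_0, ..., v_n]`. -/
def map (v : OrderedFace K n) : OrderedFace M n :=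
  ⟨φ ∘ v.1, fun a b h => v.2.1 (Λ.injOn v.toFace (v.apply_mem_face a) (v.apply_mem_face b) h),
    Λ.image_comp_eq v ▸ (Λ.equiv v.toFace).1.2.1⟩

theorem equiv_toFace (v : OrderedFace K n) :
    Λ.equiv v.toFace = ((Λ.map v).toFace, Λ.label v.toFace) :=
  Prod.ext (Subtype.ext (Λ.image_comp_eq v).symm) rfl

theorem bijective_map_label :
    Function.Bijective fun v : OrderedFace K n => (Λ.map v, Λ.label v.toFace) := by
  constructor
  · intro v v' h
    obtain ⟨hmap, hlabel⟩ := Prod.mk.inj h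
    have hface : v.toFace = v'.toFace :=
      Λ.equiv.injective (by rw [Λ.equiv_toFace, hmap, hlabel, ← Λ.equiv_toFace])
    exact OrderedFace.eq_of_comp_eq (Λ.injOn v.toFace) (congrArg Subtype.val hface)
      (congrArg Subtype.val hmap)
  · rintro ⟨u, l⟩
    let F := Λ.equiv.symm (u.toFace, l)
    have hF : Λ.equiv F = (u.toFace, l) := Λ.equiv.apply_symm_apply _
    obtain ⟨v, hv, hmap⟩ := OrderedFace.exists_lift (φ := φ) F u (by rw [Λ.image_eq, hF]; rfl)
    exact ⟨v, Prod.ext (Subtype.ext hmap) (by simp only [hv, label, hF])⟩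

/-- The labelling of the ordered `n`-faces of `K` over each ordered `n`-face of `M`. -/
noncomputable def orderedEquiv : OrderedFace K n ≃ OrderedFace M n × ι :=
  Equiv.ofBijective _ Λ.bijective_map_label

/-- The ordered face of `K` over `u` with label `l`. -/
noncomputable def lift (u : OrderedFace M n) (l : ι) : OrderedFace K n :=
  Λ.orderedEquiv.symm (u, l)

theorem map_lift (u : OrderedFace M n) (l : ι) : Λ.map (Λ.lift u l) = u :=
  congrArg Prod.fst (Λ.orderedEquiv.apply_symm_apply (u, l))

theorem label_lift (u : OrderedFace M n) (l : ι) : Λ.label (Λ.lift u l).toFace = l :=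
  congrArg Prod.snd (Λ.orderedEquiv.apply_symm_apply (u, l))

theorem lift_map_label (v : OrderedFace K n) : Λ.lift (Λ.map v) (Λ.label v.toFace) = v :=
  Λ.orderedEquiv.symm_apply_apply v

theorem lift_eq_of_map_eq {v : OrderedFace K n} {u : OrderedFace M n} (h : Λ.map v = u) :
    Λ.lift u (Λ.label v.toFace) = v :=
  h ▸ Λ.lift_map_label v

theorem lift_reorder (u : OrderedFace M n) (l : ι) (σ : Equiv.Perm (Fin (n + 1))) :
    Λ.lift (u.reorder σ) l = (Λ.lift u l).reorder σ := by
  have hmap : Λ.map ((Λ.lift u l).reorder σ) = u.reorder σ :=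
    congrArg (OrderedFace.reorder · σ) (Λ.map_lift u l)
  conv_lhs => rw [← Λ.label_lift u l, ← OrderedFace.toFace_reorder _ σ]
  exact Λ.lift_eq_of_map_eq hmap

theorem face_map (v : OrderedFace K n) : (Λ.map v).face = v.face.image φ :=
  (Λ.image_comp_eq v).trans (Λ.image_eq v.toFace).symm

variable {wK : FaceWeight K} {wM : FaceWeight M}

/-- The cochain `f` on `M`, transported to the face of `K` with label `l` over each face of `M` and
multiplied by `s l`. -/
def pullback (s : ι → ℂ) : Cochain M wM n →ₗ[ℂ] Cochain K wK n where
  toFun f := Cochain.mk (fun v => s (Λ.label v.toFace) * f.val (Λ.map v)) fun v σ => by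
    rw [OrderedFace.toFace_reorder, show Λ.map (v.reorder σ) = (Λ.map v).reorder σ from rfl,
      Cochain.val_reorder]
    ring
  map_add' _ _ := Cochain.ext fun _ => mul_add _ _ _
  map_smul' _ _ := Cochain.ext fun _ => mul_left_comm _ _ _

theorem pullback_val (s : ι → ℂ) (f : Cochain M wM n) (v : OrderedFace K n) :
    (Λ.pullback (wK := wK) s f).val v = s (Λ.label v.toFace) * f.val (Λ.map v) := rfl

variable [Fintype ι]

/-- The sum over the fibres of a cochain on `K`, the value on the face with label `l` being
multiplied by `s l`. -/
noncomputable def pushforward (s : ι → ℂ) : Cochain K wK n →ₗ[ℂ] Cochain M wM n where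
  toFun h := Cochain.mk (fun u => ∑ l, s l * h.val (Λ.lift u l)) fun u σ => by
    rw [Finset.mul_sum]
    refine Finset.sum_congr rfl fun l _ => ?_
    rw [lift_reorder, Cochain.val_reorder]
    ring
  map_add' h h' := Cochain.ext fun u => by
    simp only [Cochain.val_mk, Cochain.val_add, mul_add, Finset.sum_add_distrib]
  map_smul' c h := Cochain.ext fun u => by
    simp only [Cochain.val_mk, Cochain.val_smul, RingHom.id_apply, Finset.mul_sum, mul_left_comm]

theorem pushforward_val (s : ι → ℂ) (h : Cochain K wK n) (u : OrderedFace M n) :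
    (Λ.pushforward (wM := wM) s h).val u = ∑ l, s l * h.val (Λ.lift u l) := rfl

theorem adjoint_pullback [Fintype V] [Fintype W]
    (hw : ∀ F : Face K n, wK.toFun F.1 = wM.toFun (F.1.image φ)) (s : ι → ℂ) :
    LinearMap.adjoint (Λ.pullback (wK := wK) (wM := wM) s) =
      Λ.pushforward fun l => conj (s l) := by
  refine ((LinearMap.eq_adjoint_iff _ _).mpr fun h f => ?_).symm
  have hweight : ∀ u l, wK.toFun (Λ.lift u l).face = wM.toFun u.face := fun u l => by
    rw [← congrArg OrderedFace.face (Λ.map_lift u l), Λ.face_map]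
    exact hw (Λ.lift u l).toFace
  rw [Cochain.inner_eq, Cochain.inner_eq, ← Equiv.sum_comp Λ.orderedEquiv.symm,
    Fintype.sum_prod_type]
  congr 1
  refine Finset.sum_congr rfl fun u _ => ?_
  rw [pushforward_val, map_sum, Finset.sum_mul, Finset.mul_sum]
  refine Finset.sum_congr rfl fun l _ => ?_
  change _ = (wK.toFun (Λ.lift u l).face : ℂ) *
    (conj (h.val (Λ.lift u l)) * (Λ.pullback s f).val (Λ.lift u l))
  rw [pullback_val, Λ.map_lift, Λ.label_lift, hweight, map_mul, Complex.conj_conj]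
  ring

theorem sum_pullback_val (S : Matrix ι ι ℂ) (f : ι → Cochain M wM n) (v : OrderedFace K n) :
    (∑ j, Λ.pullback (wK := wK) (S j) (f j)).val v =
      ((fun j => (f j).val (Λ.map v)) ᵥ* S) (Λ.label v.toFace) := by
  let evalHom : Cochain K wK n →+ ℂ := ⟨⟨fun g => g.val v, rfl⟩, fun _ _ => rfl⟩
  refine (map_sum evalHom _ _).trans (Finset.sum_congr rfl fun j _ => mul_comm _ _)

theorem pushforward_col_val (T : Matrix ι ι ℂ) (h : Cochain K wK n) (j : ι)
    (u : OrderedFace M n) :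
    (Λ.pushforward (wM := wM) (T.col j) h).val u = ((fun l => h.val (Λ.lift u l)) ᵥ* T) j :=
  Finset.sum_congr rfl fun _ _ => mul_comm _ _

variable [DecidableEq ι] {S T : Matrix ι ι ℂ}

theorem sum_pullback_pushforward (hTS : T * S = 1) (h : Cochain K wK n) :
    ∑ j, Λ.pullback (wK := wK) (S j) (Λ.pushforward (wM := wM) (T.col j) h) = h := by
  refine Cochain.ext fun v => ?_
  rw [sum_pullback_val]
  simp only [pushforward_col_val]
  rw [Matrix.vecMul_vecMul, hTS, Matrix.vecMul_one, lift_map_label]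

theorem pushforward_sum_pullback (hST : S * T = 1) (f : ι → Cochain M wM n) (j : ι) :
    Λ.pushforward (T.col j) (∑ j, Λ.pullback (wK := wK) (S j) (f j)) = f j := by
  refine Cochain.ext fun u => ?_
  rw [pushforward_col_val]
  simp only [sum_pullback_val, map_lift, label_lift]
  rw [Matrix.vecMul_vecMul, hST, Matrix.vecMul_one]

/-- Cochains on `K` as tuples of cochains on `M`: for an invertible matrix `S`, the combinations of
the pullbacks along its rows. -/
noncomputable def sumPullbackEquiv (hST : S * T = 1) :
    (ι → Cochain M wM n) ≃ₗ[ℂ] Cochain K wK n :=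
  LinearEquiv.ofLinearMap (LinearMap.lsum ℂ _ ℂ fun j => Λ.pullback (S j))
    (LinearMap.pi fun j => Λ.pushforward (T.col j))
    (LinearMap.ext fun h => by
      rw [LinearMap.comp_apply, LinearMap.lsum_apply]
      simpa using Λ.sum_pullback_pushforward (mul_eq_one_comm.mp hST) h)
    (LinearMap.ext fun f => funext fun j => by
      rw [LinearMap.comp_apply, LinearMap.lsum_apply]
      simpa using Λ.pushforward_sum_pullback hST f j)

theorem sumPullbackEquiv_apply (hST : S * T = 1) (f : ι → Cochain M wM n) :
    Λ.sumPullbackEquiv (wK := wK) hST f = ∑ j, Λ.pullback (S j) (f j) := by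
  simp [sumPullbackEquiv]

end FaceLabelling

end Labellings

section Coboundary

namespace FaceLabelling

variable {V W : Type*} [DecidableEq V] [DecidableEq W] {K : AbstractSimplicialComplex V}
  {M : AbstractSimplicialComplex W} {φ : V → W} {n : ℕ} {ι : Type*}

/-- The labels of incident faces `F`, `F'` of `K` are related by the permutation `p G G'` assigned
to their images `G`, `G'`. -/
def IsCompatible (Λ₀ : FaceLabelling K M φ n ι) (Λ₁ : FaceLabelling K M φ (n + 1) ι)
    (p : Face M n → Face M (n + 1) → Equiv.Perm ι) : Prop :=
  ∀ F F', Incident K F.1 F'.1 →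
    Λ₀.label F = p (Λ₀.equiv F).1 (Λ₁.equiv F').1 (Λ₁.label F')

variable {Λ₀ : FaceLabelling K M φ n ι} {Λ₁ : FaceLabelling K M φ (n + 1) ι}
  {p : Face M n → Face M (n + 1) → Equiv.Perm ι}

theorem IsCompatible.label_drop (hp : IsCompatible Λ₀ Λ₁ p) (v : OrderedFace K (n + 1))
    (j : Fin (n + 2)) : Λ₀.label (v.drop j).toFace =
      p ((Λ₁.map v).drop j).toFace (Λ₁.map v).toFace (Λ₁.label v.toFace) := by
  rw [hp (v.drop j).toFace v.toFace (v.incident_drop j), Λ₀.equiv_toFace, Λ₁.equiv_toFace]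
  rfl

theorem IsCompatible.lift_drop (hp : IsCompatible Λ₀ Λ₁ p) (u : OrderedFace M (n + 1))
    (j : Fin (n + 2)) (l : ι) :
    Λ₀.lift (u.drop j) (p (u.drop j).toFace u.toFace l) = (Λ₁.lift u l).drop j := by
  have hmap : Λ₀.map ((Λ₁.lift u l).drop j) = u.drop j :=
    congrArg (OrderedFace.drop · j) (Λ₁.map_lift u l)
  rw [← Λ₀.lift_eq_of_map_eq hmap, hp.label_drop, Λ₁.map_lift, Λ₁.label_lift]

variable {wK : FaceWeight K} {wM : FaceWeight M} {ω : IncidenceWeight M} {s : ι → ℂ}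

theorem IsCompatible.coboundary_comp_pullback (hp : IsCompatible Λ₀ Λ₁ p)
    (hs : ∀ G G', Incident M G.1 G'.1 → ∀ l, s (p G G' l) = ω.toFun G.1 G'.1 * s l) :
    coboundary K wK (IncidenceWeight.trivial K) n ∘ₗ Λ₀.pullback s =
      Λ₁.pullback s ∘ₗ coboundary M wM ω n := by
  refine LinearMap.ext fun f => Cochain.ext fun v => ?_
  rw [LinearMap.comp_apply, LinearMap.comp_apply, coboundary_val, pullback_val, coboundary_val,
    Finset.mul_sum]
  refine Finset.sum_congr rfl fun j _ => ?_
  rw [OrderedFace.trivial_toFun_drop, pullback_val, hp.label_drop,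
    hs _ _ ((Λ₁.map v).incident_drop j)]
  change _ = _ * (_ * f.val (Λ₀.map (v.drop j)))
  change _ * 1 * (ω.toFun ((Λ₁.map v).drop j).face (Λ₁.map v).face * _ * _) = _
  ring

variable [Fintype ι]

theorem IsCompatible.pushforward_comp_coboundary (hp : IsCompatible Λ₀ Λ₁ p)
    (hs : ∀ G G', Incident M G.1 G'.1 → ∀ l, ω.toFun G.1 G'.1 * s (p G G' l) = s l) :
    Λ₁.pushforward s ∘ₗ coboundary K wK (IncidenceWeight.trivial K) n =
      coboundary M wM ω n ∘ₗ Λ₀.pushforward s := by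
  refine LinearMap.ext fun h => Cochain.ext fun u => ?_
  rw [LinearMap.comp_apply, LinearMap.comp_apply, coboundary_val, pushforward_val]
  simp only [coboundary_val, OrderedFace.trivial_toFun_drop, Finset.mul_sum]
  rw [Finset.sum_comm]
  refine Finset.sum_congr rfl fun j _ => ?_
  rw [pushforward_val, Finset.mul_sum,
    ← Equiv.sum_comp (p (u.drop j).toFace u.toFace) fun m => _ * (_ * h.val (Λ₀.lift _ m))]
  refine Finset.sum_congr rfl fun l _ => ?_
  rw [hp.lift_drop, ← hs (u.drop j).toFace u.toFace (u.incident_drop j) l]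
  change ω.toFun (u.drop j).face u.face * _ * _ = _
  ring

variable [Fintype V] [Fintype W] [DecidableEq ι]

theorem IsCompatible.spec_upLaplacian_eq_sum (hp : IsCompatible Λ₀ Λ₁ p)
    (hw₀ : ∀ F : Face K n, wK.toFun F.1 = wM.toFun (F.1.image φ))
    (hw₁ : ∀ F : Face K (n + 1), wK.toFun F.1 = wM.toFun (F.1.image φ))
    {S : Matrix ι ι ℂ} (hS : IsUnit S) (ω : ι → IncidenceWeight M)
    (hω : ∀ j (G : Face M n) (G' : Face M (n + 1)), Incident M G.1 G'.1 →
      conj ((ω j).toFun G.1 G'.1) * (ω j).toFun G.1 G'.1 = 1)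
    (hSω : ∀ j G G', Incident M G.1 G'.1 → ∀ l, S j (p G G' l) = (ω j).toFun G.1 G'.1 * S j l) :
    Spec (upLaplacian K wK n) = ∑ j, Spec (weightedUpLaplacian M wM (ω j) n) := by
  obtain ⟨T, hST⟩ := hS.exists_right_inv
  have hconj : ∀ j G G', Incident M G.1 G'.1 → ∀ l,
      (ω j).toFun G.1 G'.1 * conj (S j (p G G' l)) = conj (S j l) := fun j G G' h l => by
    rw [hSω j G G' h, map_mul, ← mul_assoc, mul_comm ((ω j).toFun _ _), hω j G G' h, one_mul]
  have hcomm : ∀ j, upLaplacian K wK n ∘ₗ Λ₀.pullback (S j) =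
      Λ₀.pullback (S j) ∘ₗ weightedUpLaplacian M wM (ω j) n := fun j => by
    refine adjoint_comp_self_comp_eq (hp.coboundary_comp_pullback (hSω j)) ?_
    rw [Λ₀.adjoint_pullback hw₀, Λ₁.adjoint_pullback hw₁]
    exact hp.pushforward_comp_coboundary (hconj j)
  refine spec_eq_sum (Λ₀.sumPullbackEquiv hST) fun f => ?_
  rw [sumPullbackEquiv_apply, sumPullbackEquiv_apply, map_sum]
  exact Finset.sum_congr rfl fun j _ => LinearMap.congr_fun (hcomm j) (f j)

end FaceLabelling

end Coboundary

section DerivedGraphs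

theorem exists_eq_sumCongr {A B C D : Type*} {e : A ⊕ B ≃ C ⊕ D}
    (h : ∀ x, (e x).isLeft = x.isLeft) :
    ∃ (e₀ : A ≃ C) (e₁ : B ≃ D), e = Equiv.sumCongr e₀ e₁ := by
  have hsymm : ∀ y, (e.symm y).isLeft = y.isLeft := fun y => by
    rw [← h, e.apply_symm_apply]
  have hleft : ∀ a, ∃ c, e (.inl a) = .inl c := fun a => Sum.isLeft_iff.mp (h _)
  have hright : ∀ b, ∃ d, e (.inr b) = .inr d := fun b =>
    Sum.isRight_iff.mp (Sum.isLeft_eq_false.mp (h _))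
  have hleft' : ∀ c, ∃ a, e.symm (.inl c) = .inl a := fun c => Sum.isLeft_iff.mp (hsymm _)
  have hright' : ∀ d, ∃ b, e.symm (.inr d) = .inr b := fun d =>
    Sum.isRight_iff.mp (Sum.isLeft_eq_false.mp (hsymm _))
  choose f₀ hf₀ using hleft
  choose f₁ hf₁ using hright
  choose g₀ hg₀ using hleft'
  choose g₁ hg₁ using hright'
  refine ⟨⟨f₀, g₀, fun a => ?_, fun c => ?_⟩, ⟨f₁, g₁, fun b => ?_, fun d => ?_⟩, ?_⟩
  · exact Sum.inl_injective (by rw [← hg₀, ← hf₀, e.symm_apply_apply])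
  · exact Sum.inl_injective (by rw [← hf₀, ← hg₀, e.apply_symm_apply])
  · exact Sum.inr_injective (by rw [← hg₁, ← hf₁, e.symm_apply_apply])
  · exact Sum.inr_injective (by rw [← hf₁, ← hg₁, e.apply_symm_apply])
  · ext (a | b)
    · exact hf₀ a
    · exact hf₁ b

variable {V W : Type*} {K : AbstractSimplicialComplex V} {M : AbstractSimplicialComplex W}
  {φ : V → W} {i k : ℕ}

theorem toFace_mem (x : Face K i ⊕ Face K (i + 1)) : toFace x ∈ K := by
  rcases x with F | F <;> exact F.2.1

theorem exists_incident_face (F : Face K (i + 1)) : ∃ F₀ : Face K i, Incident K F₀.1 F.1 := by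
  classical
  obtain ⟨hF, hcard⟩ := F.2
  obtain ⟨x, hx⟩ : F.1.Nonempty := Finset.card_pos.mp (by lia)
  have hcard' : (F.1.erase x).card = i + 1 := by rw [Finset.card_erase_of_mem hx, hcard]; rfl
  have hmem : F.1.erase x ∈ K := (K.isRelLowerSet_faces hF).2 (F.1.erase_subset x)
    (Finset.card_pos.mp (by lia))
  exact ⟨⟨F.1.erase x, hmem, hcard'⟩, hmem, hF, F.1.erase_subset x, by lia⟩

variable {ψ : PermVoltage (incidenceGraph M i) k}

theorem voltage_mem {x y : Face M i ⊕ Face M (i + 1)} (h : (incidenceGraph M i).Adj x y) :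
    ψ.toFun x y ∈ voltageGroup ψ := by
  rcases x with G | G' <;> rcases y with H | H'
  · exact h.elim
  · exact (voltage ψ G H' h).2
  · rw [ψ.inv_eq _ _ h.symm]
    exact inv_mem (voltage ψ H G' h).2
  · exact h.elim

theorem exists_voltageGroup_apply_eq_of_reachable {x y : (Face M i ⊕ Face M (i + 1)) × Fin k}
    (h : (derivedGraph ψ).Reachable x y) : ∃ g ∈ voltageGroup ψ, g y.2 = x.2 := by
  obtain ⟨c⟩ := h
  induction c with
  | nil => exact ⟨1, one_mem _, rfl⟩
  | cons h _ ih =>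
    obtain ⟨g, hg, hgy⟩ := ih
    exact ⟨_, mul_mem (voltage_mem h.1) hg, by rw [Equiv.Perm.mul_apply, hgy, ← h.2]⟩

theorem existsUnique_voltageGroup_apply_eq
    (hab : ∀ g ∈ voltageGroup ψ, ∀ h ∈ voltageGroup ψ, g * h = h * g)
    (hc : (derivedGraph ψ).Connected) (a b : Fin k) :
    ∃! g : voltageGroup ψ, (g : Equiv.Perm (Fin k)) a = b := by
  obtain ⟨x, -⟩ := hc.nonempty.some
  exact existsUnique_apply_eq_of_transitive hab (fun a b =>
    exists_voltageGroup_apply_eq_of_reachable (hc.preconnected (x, b) (x, a))) a b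

variable [DecidableEq W] {η : derivedGraph ψ ≃g incidenceGraph K i}

theorem isLeft_derivedGraph_iso (hη : ∀ x l, (toFace (η (x, l))).image φ = toFace x)
    (x : Face M i ⊕ Face M (i + 1)) (l : Fin k) : (η (x, l)).isLeft = x.isLeft := by
  have hright : ∀ G' l, (η (.inr G', l)).isLeft = false := fun G' l => by
    rcases h : η (.inr G', l) with F | F
    · have hcard := Finset.card_image_le (s := F.1) (f := φ)
      have himage : F.1.image φ = G'.1 :=
        (congrArg (fun y => (toFace y).image φ) h).symm.trans (hη (.inr G') l)
      rw [himage, F.2.2, G'.2.2] at hcard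
      lia
    · rfl
  rcases x with G | G'
  · rcases h : η (.inl G, l) with F | F
    · rfl
    · -- `F` would have a neighbour `F₀` on the left, whose preimage lies on the right.
      obtain ⟨F₀, hF₀⟩ := exists_incident_face F
      obtain ⟨⟨y, m⟩, hy⟩ := η.surjective (.inl F₀)
      have hadj : (derivedGraph ψ).Adj (y, m) (.inl G, l) := η.map_adj_iff.mp <| by
        rw [hy, h]
        exact hF₀
      rcases y with H | H
      · exact hadj.1.elim
      · exact absurd (hright H m) (by rw [hy]; simp)
  · exact hright G' l

theorem exists_isCompatible (hη : ∀ x l, (toFace (η (x, l))).image φ = toFace x) :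
    ∃ (Λ₀ : FaceLabelling K M φ i (Fin k)) (Λ₁ : FaceLabelling K M φ (i + 1) (Fin k)),
      Λ₀.IsCompatible Λ₁ fun G G' => ψ.toFun (.inl G) (.inr G') := by
  obtain ⟨e₀, e₁, he⟩ := exists_eq_sumCongr
    (e := (Equiv.sumProdDistrib (Face M i) (Face M (i + 1)) (Fin k)).symm.trans η.toEquiv) <| by
      rintro (⟨G, l⟩ | ⟨G', l⟩) <;> exact isLeft_derivedGraph_iso hη _ l
  have he₀ : ∀ G l, η (.inl G, l) = .inl (e₀ (G, l)) := fun G l =>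
    Equiv.congr_fun he (.inl (G, l))
  have he₁ : ∀ G' l, η (.inr G', l) = .inr (e₁ (G', l)) := fun G' l =>
    Equiv.congr_fun he (.inr (G', l))
  refine ⟨⟨e₀.symm, fun F => ?_⟩, ⟨e₁.symm, fun F => ?_⟩, fun F F' hFF' => ?_⟩
  · have himage := hη (.inl (e₀.symm F).1) (e₀.symm F).2
    rw [he₀, Prod.mk.eta, e₀.apply_symm_apply] at himage
    exact himage
  · have himage := hη (.inr (e₁.symm F).1) (e₁.symm F).2
    rw [he₁, Prod.mk.eta, e₁.apply_symm_apply] at himage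
    exact himage
  · have hadj : (derivedGraph ψ).Adj (.inl (e₀.symm F).1, (e₀.symm F).2)
        (.inr (e₁.symm F').1, (e₁.symm F').2) := η.map_adj_iff.mp <| by
      rw [he₀, he₁, Prod.mk.eta, e₀.apply_symm_apply, Prod.mk.eta, e₁.apply_symm_apply]
      exact hFF'
    exact hadj.2

variable [Fintype V] [DecidableEq V] [Fintype W] [NeZero k] {wK : FaceWeight K} {wM : FaceWeight M}

theorem spec_upLaplacian_eq_sum_of_isCharacterDecomposition
    (hw : ∀ x : Face K i ⊕ Face K (i + 1), wK.toFun (toFace x) = wM.toFun ((toFace x).image φ))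
    (hη : ∀ x l, (toFace (η (x, l))).image φ = toFace x)
    {ϱ : Fin k → (voltageGroup ψ →* ℂˣ)} {T : Matrix (Fin k) (Fin k) ℂ}
    (hT : IsCharacterDecomposition (voltageGroup ψ) ϱ T) {ω : Fin k → IncidenceWeight M}
    (hω : ∀ j (G : Face M i) (G' : Face M (i + 1)) (h : Incident M G.1 G'.1),
      (ω j).toFun G.1 G'.1 = ((ϱ j (voltage ψ G G' h) : ℂˣ) : ℂ)) :
    Spec (upLaplacian K wK i) = ∑ j, Spec (weightedUpLaplacian M wM (ω j) i) := by
  obtain ⟨Λ₀, Λ₁, hΛ⟩ := exists_isCompatible hη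
  refine hΛ.spec_upLaplacian_eq_sum (fun F => hw (.inl F)) (fun F => hw (.inr F))
    (Matrix.isUnit_nonsing_inv_iff.mpr hT.isUnit) ω (fun j G G' h => ?_) fun j G G' h l => ?_
  · rw [hω j G G' h]
    exact conj_mul_character _ _
  · rw [hω j G G' h]
    exact hT.inv_apply_perm (voltage ψ G G' h) j l

theorem spec_upLaplacian_eq_add_sum
    (hw : ∀ x : Face K i ⊕ Face K (i + 1), wK.toFun (toFace x) = wM.toFun ((toFace x).image φ))
    (hη : ∀ x l, (toFace (η (x, l))).image φ = toFace x)
    {ϱ : Fin k → (voltageGroup ψ →* ℂˣ)} {T : Matrix (Fin k) (Fin k) ℂ}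
    (hT : IsCharacterDecomposition (voltageGroup ψ) ϱ T) {ω : Fin k → IncidenceWeight M}
    (hω : ∀ j, j ≠ 0 → ∀ (G : Face M i) (G' : Face M (i + 1)) (h : Incident M G.1 G'.1),
      (ω j).toFun G.1 G'.1 = ((ϱ j (voltage ψ G G' h) : ℂˣ) : ℂ)) :
    Spec (upLaplacian K wK i) = Spec (upLaplacian M wM i) +
      ∑ j ∈ Finset.univ.erase 0, Spec (weightedUpLaplacian M wM (ω j) i) := by
  let ω' : Fin k → IncidenceWeight M := Function.update ω 0 (IncidenceWeight.trivial M)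
  have hω'_zero : ω' 0 = IncidenceWeight.trivial M := Function.update_self ..
  have hω'_ne : ∀ j, j ≠ 0 → ω' j = ω j := fun j hj => Function.update_of_ne hj ..
  have hω' : ∀ j (G : Face M i) (G' : Face M (i + 1)) (h : Incident M G.1 G'.1),
      (ω' j).toFun G.1 G'.1 = ((ϱ j (voltage ψ G G' h) : ℂˣ) : ℂ) := fun j G G' h => by
    rcases eq_or_ne j 0 with rfl | hj
    · rw [hω'_zero, hT.first]
      exact if_pos h
    · rw [hω'_ne j hj, hω j hj G G' h]
  rw [spec_upLaplacian_eq_sum_of_isCharacterDecomposition hw hη hT hω',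
    ← Finset.add_sum_erase _ _ (Finset.mem_univ 0), hω'_zero]
  exact congrArg _ (Finset.sum_congr rfl fun j hj => by rw [hω'_ne j (Finset.ne_of_mem_erase hj)])

end DerivedGraphs

end SimplicialCovering

theorem theorem4p1_general {V W : Type*} [Fintype V] [DecidableEq V] [Fintype W] [DecidableEq W]
    (K : AbstractSimplicialComplex V) (M : AbstractSimplicialComplex W)
    (wK : FaceWeight K) (wM : FaceWeight M) (i k : ℕ) [NeZero k] (φ : V → W)
    (hw : ∀ x : Face K i ⊕ Face K (i + 1), wK.toFun (toFace x) = wM.toFun ((toFace x).image φ))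
    (ψ : PermVoltage (incidenceGraph M i) k)
    (η : derivedGraph ψ ≃g incidenceGraph K i)
    (hη : ∀ x l, (toFace (η (x, l))).image φ = toFace x)
    (hab : ∀ g ∈ voltageGroup ψ, ∀ h ∈ voltageGroup ψ, g * h = h * g) :
    ((incidenceGraph K i).Connected →
      (∀ a b : Fin k, ∃! g : voltageGroup ψ, (g : Equiv.Perm (Fin k)) a = b) ∧
        Nat.card (voltageGroup ψ) = k) ∧
    (∃ ϱ T, IsCharacterDecomposition (voltageGroup ψ) ϱ T) ∧
    (∀ ϱ T, IsCharacterDecomposition (voltageGroup ψ) ϱ T →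
      ∀ ω : Fin k → IncidenceWeight M,
        (∀ j, j ≠ 0 → ∀ (G : Face M i) (G' : Face M (i + 1)) (h : Incident M G.1 G'.1),
          (ω j).toFun G.1 G'.1 = ((ϱ j (voltage ψ G G' h) : ℂˣ) : ℂ)) →
        Spec (upLaplacian K wK i) = Spec (upLaplacian M wM i) +
          ∑ j ∈ Finset.univ.erase 0, Spec (weightedUpLaplacian M wM (ω j) i)) := by
  refine ⟨fun hK => ?_, exists_isCharacterDecomposition hab,
    fun ϱ T hT ω hω => spec_upLaplacian_eq_add_sum hw hη hT hω⟩
  have hreg := existsUnique_voltageGroup_apply_eq hab (η.connected_iff.mpr hK)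
  exact ⟨hreg, (card_eq_of_existsUnique_apply_eq _ 0 (hreg 0)).trans (Nat.card_fin k)⟩

theorem theorem4p1 {V W : Type*} [Fintype V] [DecidableEq V] [Fintype W] [DecidableEq W]
    (K : AbstractSimplicialComplex V) (M : AbstractSimplicialComplex W)
    (wK : FaceWeight K) (wM : FaceWeight M) (i k : ℕ) [NeZero k]
    (φ : V → W) (hφ : IsFoldCovering K M φ k)
    (hw : ∀ F ∈ K, wK.toFun F = wM.toFun (F.image φ))
    (ψ : PermVoltage (incidenceGraph M i) k)
    (η : derivedGraph ψ ≃g incidenceGraph K i)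
    (hη : ∀ x l, (toFace (η (x, l))).image φ = toFace x)
    (hab : ∀ g ∈ voltageGroup ψ, ∀ h ∈ voltageGroup ψ, g * h = h * g) :
    ((incidenceGraph K i).Connected →
      (∀ a b : Fin k, ∃! g : voltageGroup ψ, (g : Equiv.Perm (Fin k)) a = b) ∧
        Nat.card (voltageGroup ψ) = k) ∧
    (∃ ϱ T, IsCharacterDecomposition (voltageGroup ψ) ϱ T) ∧
    (∀ ϱ T, IsCharacterDecomposition (voltageGroup ψ) ϱ T →
      ∀ ω : Fin k → IncidenceWeight M,
        (∀ j, j ≠ 0 → ∀ (G : Face M i) (G' : Face M (i + 1)) (h : Incident M G.1 G'.1),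
          (ω j).toFun G.1 G'.1 = ((ϱ j (voltage ψ G G' h) : ℂˣ) : ℂ)) →
        Spec (upLaplacian K wK i) = Spec (upLaplacian M wM i) +
          ∑ j ∈ Finset.univ.erase 0, Spec (weightedUpLaplacian M wM (ω j) i)) :=
  theorem4p1_general K M wK wM i k φ (fun x => hw _ (toFace_mem x)) ψ η hη hab
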